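/- Let $(X_N)_{N}$ be a self-adjoint random matrix ensemble, i.e. for each $N$, $X_N$ is a random self-adjoint $N\times N$ complex matrix, and write $\mathrm{Cov}(Y,Z)=\mathbb{E}(YZ)-\mathbb{E}(Y)\mathbb{E}(Z)$ and $\mathrm{Var}(Y)=\mathbb{E}|Y-\mathbb{E}(Y)|^2$ for complex random variables, and $\mathrm{Tr}(f(X_N))=\sum_k f(\lambda_k)$ for $f:\mathbb{R}\to\mathbb{C}$, the sum being over the eigenvalues of $X_N$ with multiplicity. Assume: - (A0) the random variables $\mathrm{Tr}(X_N^n)$ have finite second moments and, for all $m,n\in\mathbb{N}$, the limits $\alpha_n=\lim_{N\to\infty}\frac1N\mathbb{E}(\mathrm{Tr}(X_N^n))$ and $\alpha_{m,n}=\lim_{N\to\infty}\mathrm{Cov}(\mathrm{Tr}(X_N^m),\mathrm{Tr}(X_N^n))$ exist; - (A1) $M>0$ is such that $\lim_{N\to\infty}N^8\,\mathbb{P}(\|X_N\|>M)=0$, where $\|\cdot\|$ is the operator norm; - (A2) $K>0$ is such that $\mathrm{Var}(\mathrm{Tr}(f(X_N)))\le K\|f'\|_\infty^2$ for every continuously differentiable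 $f:\mathbb{R}\to\mathbb{C}$ and every $N$. Let $C^1([-M,M])$ be the space of restrictions $f|_M$ to $[-M,M]$ of continuously differentiable functions $f:\mathbb{R}\to\mathbb{C}$, and put $\|h\|_M=\sup_{|x|\le M}|h(x)|$. Then there is a bilinear functional $\rho$ on $C^1([-M,M])\times C^1([-M,M])$ with $\rho(x^m,x^n)=\alpha_{m,n}$ for all $m,n\ge0$ and $|\rho(f,g)|\le K\|f'\|_M\|g'\|_M$ for all $f,g$; it is the only bilinear functional with these values on monomials that satisfies such a bound with any constant in place of $K$. Moreover, for all $z,w\in\mathbb{C}$ with $|z|,|w|>M$ the series $$G_2(z,w)=\sum_{m,n\ge1}\frac{\alpha_{m,n}}{z^{m+1}w^{n+1}}$$ converges absolutely; the function $G_2$ (the second-order Cauchy transform) extends to an analytic function, also denoted $G_2$, on $(\mathbb{C}\setminus[-M,M])^2$; and for all $z,w\in\mathbb{C}\setminus\mathbb{R}$, with $r_z(x)=\frac1{z-x}$, $$G_2(z,w)=\rho(r_z|_M,r_w|_M)=\lim_{N\to\infty}\mathrm{Cov}\big(\mathrm{Tr}((z-X_N)^{-1}),\mathrm{Tr}((w-X_N)^{-1})\big).$$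 -/

import Mathlib

open MeasureTheory Filter Topology

noncomputable section

/-- A self-adjoint random matrix ensemble: for every `N`, a random self-adjoint `N × N` complex
matrix `X N` on a sample space `Ω N` (which may depend on `N`). -/
structure SelfAdjointEnsemble (Ω : ℕ → Type*) [∀ N, MeasurableSpace (Ω N)] where
  X : ∀ N, Ω N → Matrix (Fin N) (Fin N) ℂ
  measurable_entry : ∀ N i j, Measurable fun ω => X N ω i j
  isHermitian : ∀ N ω, (X N ω).IsHermitian

/-- `Cov(Y, Z) = E(YZ) - E(Y) E(Z)` for complex random variables (bilinear, no conjugation). -/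
def ccov {S : Type*} [MeasurableSpace S] (P : Measure S) (Y Z : S → ℂ) : ℂ :=
  (∫ s, Y s * Z s ∂P) - (∫ s, Y s ∂P) * ∫ s, Z s ∂P

/-- `Var(Y) = E |Y - E(Y)|²` for a complex random variable, with values in `[0, ∞]`. -/
def evar {S : Type*} [MeasurableSpace S] (P : Measure S) (Y : S → ℂ) : ENNReal :=
  ∫⁻ s, ‖Y s - ∫ t, Y t ∂P‖ₑ ^ 2 ∂P

/-- The operator norm of a matrix acting on the Euclidean space `ℂᴺ`. -/
def matrixOpNorm {N : ℕ} (A : Matrix (Fin N) (Fin N) ℂ) : ℝ :=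
  ‖Matrix.toEuclideanCLM (n := Fin N) (𝕜 := ℂ) A‖

namespace SelfAdjointEnsemble

variable {Ω : ℕ → Type*} [∀ N, MeasurableSpace (Ω N)]

/-- `Tr(X_N ^ n)`. -/
def traceMoment (E : SelfAdjointEnsemble Ω) (N n : ℕ) (ω : Ω N) : ℂ :=
  (E.X N ω ^ n).trace

/-- The linear statistic `Tr(f(X_N)) = ∑ f(λ_k)`, summed over the eigenvalues of `X_N`,
counted with multiplicity. -/
def linStat (E : SelfAdjointEnsemble Ω) (f : ℝ → ℂ) (N : ℕ) (ω : Ω N) : ℂ :=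
  ∑ k, f ((E.isHermitian N ω).eigenvalues k)

/-- `Tr((z - X_N)⁻¹)`. -/
def traceResolvent (E : SelfAdjointEnsemble Ω) (z : ℂ) (N : ℕ) (ω : Ω N) : ℂ :=
  ((z • (1 : Matrix (Fin N) (Fin N) ℂ) - E.X N ω)⁻¹).trace

/-- The first-order moments `a n` and the second-order moments `α m n` exist.
The traces of the powers have finite second moments, so that the expectations and
covariances are genuine. -/
structure HasMoments (E : SelfAdjointEnsemble Ω) (P : ∀ N, Measure (Ω N))
    (a : ℕ → ℂ) (α : ℕ → ℕ → ℂ) : Prop where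
  memLp : ∀ N n, MemLp (E.traceMoment N n) 2 (P N)
  first : ∀ n, Tendsto (fun N : ℕ => (1 / (N : ℂ)) * ∫ ω, E.traceMoment N n ω ∂(P N))
    atTop (𝓝 (a n))
  second : ∀ m n, Tendsto (fun N => ccov (P N) (E.traceMoment N m) (E.traceMoment N n))
    atTop (𝓝 (α m n))

/-- Tail bound for the operator norm with constant `M`: `N⁸ P(‖X_N‖ > M) → 0`. -/
def NormTail (E : SelfAdjointEnsemble Ω) (P : ∀ N, Measure (Ω N)) (M : ℝ) : Prop :=
  Tendsto (fun N : ℕ => (N : ℝ) ^ 8 * (P N).real {ω | M < matrixOpNorm (E.X N ω)})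
    atTop (𝓝 0)

/-- Poincaré-type inequality with constant `K`: `Var(Tr(f(X_N))) ≤ K ‖f'‖∞²` for every complex `C¹`
function `f` on `ℝ`. Both sides take values in `[0, ∞]`. -/
def Poincare (E : SelfAdjointEnsemble Ω) (P : ∀ N, Measure (Ω N)) (K : ℝ) : Prop :=
  ∀ f : ℝ → ℂ, ContDiff ℝ 1 f → ∀ N,
    evar (P N) (E.linStat f N) ≤ ENNReal.ofReal K * (⨆ x, ‖deriv f x‖ₑ) ^ 2

end SelfAdjointEnsemble

/-- `C¹([-M, M])`: the restrictions to `[-M, M]` of the complex `C¹` functions on `ℝ`. -/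
def C1On (M : ℝ) : Submodule ℂ (Set.Icc (-M) M → ℂ) where
  carrier := {h | ∃ f : ℝ → ℂ, ContDiff ℝ 1 f ∧ (Set.Icc (-M) M).domRestrict f = h}
  zero_mem' := ⟨0, contDiff_const, rfl⟩
  add_mem' := by
    rintro _ _ ⟨f, hf, rfl⟩ ⟨g, hg, rfl⟩
    exact ⟨f + g, hf.add hg, rfl⟩
  smul_mem' := by
    rintro c _ ⟨f, hf, rfl⟩
    exact ⟨c • f, contDiff_const.smul hf, rfl⟩

/-- The restriction `f|_M`, as an element of `C¹([-M, M])`. -/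
def restrC1 (M : ℝ) (f : ℝ → ℂ) (hf : ContDiff ℝ 1 f) : C1On M :=
  ⟨(Set.Icc (-M) M).domRestrict f, f, hf, rfl⟩

/-- The monomial `x ^ n` as a complex function on `ℝ`. -/
def monomialFn (n : ℕ) : ℝ → ℂ := fun x => (x : ℂ) ^ n

theorem contDiff_monomialFn (n : ℕ) : ContDiff ℝ 1 (monomialFn n) :=
  Complex.ofRealCLM.contDiff.pow n

/-- `r_z(x) = 1 / (z - x)`. -/
def resolventFn (z : ℂ) : ℝ → ℂ := fun x => 1 / (z - (x : ℂ))

theorem contDiff_resolventFn {z : ℂ} (hz : z.im ≠ 0) : ContDiff ℝ 1 (resolventFn z) := by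
  have hd : ContDiff ℝ 1 fun x : ℝ => z - (x : ℂ) :=
    contDiff_const.sub Complex.ofRealCLM.contDiff
  have he : resolventFn z = fun x : ℝ => (z - (x : ℂ))⁻¹ := funext fun x => one_div _
  rw [he]
  refine hd.inv fun x h => hz ?_
  have := congrArg Complex.im h
  simpa using this

/-- `ρ` is a bilinear functional on `C¹([-M, M])` that extends the one given on polynomials by
`ρ(x^m, x^n) = α m n`, and `|ρ(f, g)| ≤ K ‖f'‖_M ‖g'‖_M`, where `‖·‖_M` is the supremum over
`[-M, M]`. -/
structure IsBoundedExtension (α : ℕ → ℕ → ℂ) (M K : ℝ)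
    (ρ : C1On M →ₗ[ℂ] C1On M →ₗ[ℂ] ℂ) : Prop where
  monomial : ∀ m n, ρ (restrC1 M (monomialFn m) (contDiff_monomialFn m))
    (restrC1 M (monomialFn n) (contDiff_monomialFn n)) = α m n
  bound : ∀ (f g : ℝ → ℂ) (hf : ContDiff ℝ 1 f) (hg : ContDiff ℝ 1 g),
    ‖ρ (restrC1 M f hf) (restrC1 M g hg)‖ ≤
      K * (⨆ x : Set.Icc (-M) M, ‖deriv f x‖) * ⨆ x : Set.Icc (-M) M, ‖deriv g x‖

/-- The terms `α_{m,n} / (z^{m+1} w^{n+1})`, `m, n ≥ 1`, of the second-order Cauchy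
transform. -/
def cauchyTerm (α : ℕ → ℕ → ℂ) (z w : ℂ) (p : ℕ+ × ℕ+) : ℂ :=
  α p.1 p.2 / (z ^ ((p.1 : ℕ) + 1) * w ^ ((p.2 : ℕ) + 1))

/-- The second-order Cauchy transform `G₂(z, w)`, for `|z|, |w| > M`. -/
def secondOrderCauchy (α : ℕ → ℕ → ℂ) (z w : ℂ) : ℂ :=
  ∑' p, cauchyTerm α z w p

/-- `ℂ \ [-M, M]`. -/
def cutPlane (M : ℝ) : Set ℂ := (Complex.ofReal '' Set.Icc (-M) M)ᶜ

end

/-!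
Only the derivatives of the test functions on `[-M, M]` matter asymptotically, and the whole theorem
is the convergence of one sequence of uniformly bounded bilinear functionals on `C([-M, M])`.

Every `u` in `C([-M, M])` is extended to `ℝ` by constants and integrated; the result,
`clampPrimitive u`, is affine outside `[-M, M]` and its derivative on the whole line is bounded by
`‖u‖`. The Cauchy-Schwarz and Poincaré inequalities then bound the covariance of the linear statistics
of `clampPrimitive u` and `clampPrimitive v` by `K ‖u‖ ‖v‖`, uniformly in `N`. If `f` is `C¹` and of
polynomial growth, then `f` and `clampPrimitive f'` differ by a constant and by a function `d` that
vanishes on `[-M, M]`. Constants do not change covariances, and `Tr d(X_N)` vanishes unless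
`‖X_N‖ > M`, so that the tail bound and the moments make its second moment tend to `0`
(`HasMoments.tendsto_integral_sq_linStat_of_eqOn_zero`). Hence
`Cov(Tr f(X_N), Tr g(X_N))` and the bilinear functional at `(f', g')` have the same asymptotics
(`HasMoments.tendsto_ccov_linStat_sub`).

On monomials the limit is the second-order moment. The derivatives of polynomials are dense in
`C([-M, M])` by the Weierstrass theorem, so uniform boundedness gives convergence everywhere to a
functional `B` with the same bound (`HasMoments.exists_bilinear_limit_ccov`). Then `ρ(f, g) = B(f', g')`
is the required extension, and density gives its uniqueness.

Since `r_z' = (z - x)⁻²`, the transform is `G₂(z, w) = B((z - x)⁻², (w - x)⁻²)`. It is analytic because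
inversion is analytic on the units of the Banach algebra `C([-M, M])`, and expanding both arguments
in powers of `x`, absolutely for `|z|, |w| > M`, gives the series. As `r_z` is bounded
for non-real `z`, the limit of the covariances of the traces of resolvents is an instance of the
convergence above.
-/

/-! ### Covariances of square-integrable complex random variables -/

section Covariance

variable {S : Type*} [MeasurableSpace S] {P : Measure S}

/-- The variance `E |Y - E(Y)|²` as a real number; it agrees with `evar` on `L²`. -/
noncomputable def rvar (P : Measure S) (Y : S → ℂ) : ℝ := ∫ s, ‖Y s - ∫ t, Y t ∂P‖ ^ 2 ∂P

theorem norm_integral_mul_le_sqrt {Y Z : S → ℂ} (hY : MemLp Y 2 P) (hZ : MemLp Z 2 P) :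
    ‖∫ s, Y s * Z s ∂P‖ ≤ √(∫ s, ‖Y s‖ ^ 2 ∂P) * √(∫ s, ‖Z s‖ ^ 2 ∂P) := by
  refine (norm_integral_le_integral_norm _).trans ?_
  have h := integral_mul_norm_le_Lp_mul_Lq (μ := P) (f := Y) (g := Z)
    (p := 2) (q := 2) Real.HolderConjugate.two_two (by simpa using hY) (by simpa using hZ)
  simpa [Real.sqrt_eq_rpow, norm_mul] using h

theorem ccov_comm (Y Z : S → ℂ) : ccov P Y Z = ccov P Z Y := by
  simp only [ccov, mul_comm]

theorem ccov_smul_left (c : ℂ) (Y Z : S → ℂ) : ccov P (c • Y) Z = c * ccov P Y Z := by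
  simp only [ccov, Pi.smul_apply, smul_eq_mul, mul_assoc, integral_const_mul]
  ring

theorem ccov_smul_right (c : ℂ) (Y Z : S → ℂ) : ccov P Y (c • Z) = c * ccov P Y Z := by
  rw [ccov_comm, ccov_smul_left, ccov_comm]

variable [IsProbabilityMeasure P]

theorem ccov_const_left (c : ℂ) (Z : S → ℂ) : ccov P (fun _ => c) Z = 0 := by
  simp [ccov, integral_const_mul]

theorem ccov_const_right (c : ℂ) (Y : S → ℂ) : ccov P Y (fun _ => c) = 0 := by
  rw [ccov_comm, ccov_const_left]

theorem ccov_add_left {Y Y' Z : S → ℂ} (hY : MemLp Y 2 P) (hY' : MemLp Y' 2 P)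
    (hZ : MemLp Z 2 P) : ccov P (Y + Y') Z = ccov P Y Z + ccov P Y' Z := by
  have h1 : Integrable Y P := hY.integrable (by norm_num)
  have h2 : Integrable Y' P := hY'.integrable (by norm_num)
  have i1 : Integrable (fun s => Y s * Z s) P := hY.integrable_mul hZ
  have i2 : Integrable (fun s => Y' s * Z s) P := hY'.integrable_mul hZ
  simp only [ccov, Pi.add_apply, add_mul]
  rw [integral_add i1 i2, integral_add h1 h2]
  ring

theorem ccov_add_right {Y Z Z' : S → ℂ} (hY : MemLp Y 2 P) (hZ : MemLp Z 2 P)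
    (hZ' : MemLp Z' 2 P) : ccov P Y (Z + Z') = ccov P Y Z + ccov P Y Z' := by
  rw [ccov_comm, ccov_add_left hZ hZ' hY, ccov_comm Z, ccov_comm Z']

theorem ccov_eq_integral_centered {Y Z : S → ℂ} (hY : MemLp Y 2 P) (hZ : MemLp Z 2 P) :
    ccov P Y Z = ∫ s, (Y s - ∫ t, Y t ∂P) * (Z s - ∫ t, Z t ∂P) ∂P := by
  have h1 : Integrable Y P := hY.integrable (by norm_num)
  have h2 : Integrable Z P := hZ.integrable (by norm_num)
  set a := ∫ t, Y t ∂P with ha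
  set b := ∫ t, Z t ∂P with hb
  have e : (fun s => (Y s - a) * (Z s - b)) = fun s => Y s * Z s - a * Z s - (Y s * b - a * b) := by
    funext s; ring
  have i1 : Integrable (fun s => Y s * Z s) P := hY.integrable_mul hZ
  have i2 : Integrable (fun s => a * Z s) P := h2.const_mul a
  have i3 : Integrable (fun s => Y s * b) P := h1.mul_const b
  have i4 : Integrable (fun _ : S => a * b) P := integrable_const _
  have i5 : Integrable (fun s => Y s * Z s - a * Z s) P := i1.sub i2
  have i6 : Integrable (fun s => Y s * b - a * b) P := i3.sub i4
  rw [e, integral_sub i5 i6, integral_sub i1 i2,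
    integral_sub i3 i4, integral_const_mul, integral_mul_const, ← ha, ← hb]
  simp [ccov, a, b]

theorem norm_ccov_le {Y Z : S → ℂ} (hY : MemLp Y 2 P) (hZ : MemLp Z 2 P) :
    ‖ccov P Y Z‖ ≤ √(rvar P Y) * √(rvar P Z) := by
  rw [ccov_eq_integral_centered hY hZ]
  exact norm_integral_mul_le_sqrt (hY.sub (memLp_const _)) (hZ.sub (memLp_const _))

theorem rvar_le_integral_sq {Y : S → ℂ} (hY : MemLp Y 2 P) :
    rvar P Y ≤ ∫ s, ‖Y s‖ ^ 2 ∂P := by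
  have h1 : Integrable Y P := hY.integrable (by norm_num)
  have h2 : Integrable (fun s => ‖Y s‖ ^ 2) P := hY.integrable_norm_pow (p := 2) (by norm_num)
  unfold rvar
  set c := ∫ t, Y t ∂P with hc
  have e : ∀ s, ‖Y s - c‖ ^ 2 =
      ‖Y s‖ ^ 2 - (2 * (starRingEnd ℂ c * Y s).re - ‖c‖ ^ 2) := by
    intro s
    simp only [Complex.sq_norm, Complex.normSq_apply, Complex.sub_re, Complex.sub_im,
      Complex.mul_re, Complex.conj_re, Complex.conj_im]
    ring
  have i3 : Integrable (fun s => 2 * (starRingEnd ℂ c * Y s).re) P :=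
    ((h1.const_mul (starRingEnd ℂ c)).re).const_mul 2
  have i4 : Integrable (fun s => 2 * (starRingEnd ℂ c * Y s).re - ‖c‖ ^ 2) P :=
    i3.sub (integrable_const _)
  have e3 : ∫ s, (starRingEnd ℂ c * Y s).re ∂P = ‖c‖ ^ 2 := by
    have h : ∫ s, (starRingEnd ℂ c * Y s).re ∂P = (∫ s, starRingEnd ℂ c * Y s ∂P).re :=
      integral_re (𝕜 := ℂ) (h1.const_mul (starRingEnd ℂ c))
    rw [h, integral_const_mul, ← hc, ← Complex.normSq_eq_conj_mul_self, Complex.ofReal_re,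
      Complex.sq_norm]
  simp_rw [e]
  rw [integral_sub h2 i4, integral_sub i3 (integrable_const _), integral_const_mul, e3]
  simp only [integral_const, probReal_univ, smul_eq_mul, one_mul]
  nlinarith [sq_nonneg ‖c‖]

theorem ofReal_rvar {Y : S → ℂ} (hY : MemLp Y 2 P) : ENNReal.ofReal (rvar P Y) = evar P Y := by
  have h : Integrable (fun s => ‖Y s - ∫ t, Y t ∂P‖ ^ 2) P :=
    (hY.sub (memLp_const _)).integrable_norm_pow (p := 2) (by norm_num)
  unfold rvar evar
  rw [ofReal_integral_eq_lintegral_ofReal h (ae_of_all _ fun s => by positivity)]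
  refine lintegral_congr fun s => ?_
  rw [ENNReal.ofReal_pow (norm_nonneg _), ofReal_norm]

end Covariance

/-! ### Traces and norms in terms of eigenvalues -/

section Spectral

variable {N : ℕ} {A : Matrix (Fin N) (Fin N) ℂ}

theorem trace_conjStarAlgAut (U : unitary (Matrix (Fin N) (Fin N) ℂ))
    (B : Matrix (Fin N) (Fin N) ℂ) :
    (Unitary.conjStarAlgAut ℂ (Matrix (Fin N) (Fin N) ℂ) U B).trace = B.trace := by
  rw [Unitary.conjStarAlgAut_apply, Matrix.trace_mul_cycle, Unitary.coe_star_mul_self, one_mul]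

theorem trace_pow_eq_sum_eigenvalues (hA : A.IsHermitian) (n : ℕ) :
    (A ^ n).trace = ∑ k, ((hA.eigenvalues k : ℝ) : ℂ) ^ n := by
  conv_lhs => rw [hA.spectral_theorem]
  rw [← map_pow, trace_conjStarAlgAut, Matrix.diagonal_pow, Matrix.trace_diagonal]
  rfl

theorem trace_resolvent_eq_sum_eigenvalues (hA : A.IsHermitian) {z : ℂ} (hz : z.im ≠ 0) :
    ((z • (1 : Matrix (Fin N) (Fin N) ℂ) - A)⁻¹).trace =
      ∑ k, 1 / (z - ((hA.eigenvalues k : ℝ) : ℂ)) := by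
  set φ := Unitary.conjStarAlgAut ℂ (Matrix (Fin N) (Fin N) ℂ) hA.eigenvectorUnitary
  set d : Fin N → ℂ := fun k => ((hA.eigenvalues k : ℝ) : ℂ)
  have hd : A = φ (Matrix.diagonal d) := hA.spectral_theorem
  have hne : ∀ k, z - d k ≠ 0 := fun k h => hz (by simpa [d] using congrArg Complex.im h)
  have hinv : (z • (1 : Matrix (Fin N) (Fin N) ℂ) - A)⁻¹ =
      φ (Matrix.diagonal fun k => 1 / (z - d k)) := by
    refine Matrix.inv_eq_left_inv ?_
    have h1 : z • (1 : Matrix (Fin N) (Fin N) ℂ) - A = φ (Matrix.diagonal fun k => z - d k) := by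
      rw [hd, ← map_one φ, ← map_smul, ← map_sub]
      congr 1
      ext i j
      by_cases h : i = j <;> simp [h, Matrix.diagonal]
    rw [h1, ← map_mul, Matrix.diagonal_mul_diagonal, ← map_one φ, ← Matrix.diagonal_one]
    congr 2
    funext k
    exact one_div_mul_cancel (hne k)
  rw [hinv, trace_conjStarAlgAut, Matrix.trace_diagonal]

theorem abs_eigenvalue_le_matrixOpNorm (hA : A.IsHermitian) (k : Fin N) :
    |hA.eigenvalues k| ≤ matrixOpNorm A := by
  have h := (Matrix.toEuclideanCLM (n := Fin N) (𝕜 := ℂ) A).le_opNorm (hA.eigenvectorBasis k)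
  have e : Matrix.toEuclideanCLM (n := Fin N) (𝕜 := ℂ) A (hA.eigenvectorBasis k) =
      hA.eigenvalues k • hA.eigenvectorBasis k := by
    ext i
    have := congrFun (hA.mulVec_eigenvectorBasis k) i
    simpa using this
  have hn : ‖hA.eigenvectorBasis k‖ = 1 := hA.eigenvectorBasis.orthonormal.1 k
  rw [e, norm_smul, hn, mul_one, mul_one] at h
  exact h

end Spectral

/-! ### Functions of polynomial growth -/

theorem exists_polynomial_near_complex (a b : ℝ) {f : ℝ → ℂ} (hf : ContinuousOn f (Set.Icc a b))
    {ε : ℝ} (hε : 0 < ε) :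
    ∃ p : Polynomial ℂ, ∀ x ∈ Set.Icc a b, ‖p.eval (x : ℂ) - f x‖ < ε := by
  obtain ⟨p, hp⟩ := exists_polynomial_near_of_continuousOn a b (fun x => (f x).re)
    (Complex.continuous_re.comp_continuousOn hf) (ε / 2) (half_pos hε)
  obtain ⟨q, hq⟩ := exists_polynomial_near_of_continuousOn a b (fun x => (f x).im)
    (Complex.continuous_im.comp_continuousOn hf) (ε / 2) (half_pos hε)
  refine ⟨p.map Complex.ofRealHom + Polynomial.C Complex.I * q.map Complex.ofRealHom,
    fun x hx => ?_⟩
  have e : ∀ r : Polynomial ℝ, (r.map Complex.ofRealHom).eval (x : ℂ) = ((r.eval x : ℝ) : ℂ) :=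
    fun r => by
      have := Polynomial.eval_map_apply (f := Complex.ofRealHom) (p := r) x
      simpa using this
  rw [Polynomial.eval_add, Polynomial.eval_mul, Polynomial.eval_C, e, e]
  refine (Complex.norm_le_abs_re_add_abs_im _).trans_lt ?_
  have h1 := hp x hx
  have h2 := hq x hx
  simp only [Complex.sub_re, Complex.add_re, Complex.mul_re, Complex.I_re, Complex.ofReal_re,
    Complex.I_im, Complex.ofReal_im, Complex.sub_im, Complex.add_im, Complex.mul_im]
  simp only [zero_mul, mul_zero, sub_self, add_zero, one_mul, zero_add]
  linarith

/-- `f` is continuous and grows at most polynomially. The even power `2 * k` makes the bounding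
sum over eigenvalues a trace `N + Tr(X ^ (2k))`. -/
structure HasPolyGrowth (f : ℝ → ℂ) : Prop where
  continuous : Continuous f
  bound : ∃ (C : ℝ) (k : ℕ), 0 ≤ C ∧ ∀ x, ‖f x‖ ≤ C * (1 + x ^ (2 * k))

namespace HasPolyGrowth

theorem pow_two_mul_le {k l : ℕ} (h : k ≤ l) (x : ℝ) : x ^ (2 * k) ≤ 1 + x ^ (2 * l) := by
  rw [pow_mul, pow_mul]
  rcases le_total (x ^ 2) 1 with h1 | h1
  · have := pow_le_one₀ (n := k) (sq_nonneg x) h1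
    have : 0 ≤ (x ^ 2) ^ l := by positivity
    linarith
  · have := pow_le_pow_right₀ h1 h
    linarith

theorem add {f g : ℝ → ℂ} (hf : HasPolyGrowth f) (hg : HasPolyGrowth g) :
    HasPolyGrowth (f + g) := by
  obtain ⟨C, k, hC, hfb⟩ := hf.bound
  obtain ⟨D, l, hD, hgb⟩ := hg.bound
  refine ⟨hf.continuous.add hg.continuous, 2 * C + 2 * D, k + l, by positivity, fun x => ?_⟩
  have h1 := pow_two_mul_le (Nat.le_add_right k l) x
  have h2 := pow_two_mul_le (Nat.le_add_left l k) x
  have h0 : 0 ≤ x ^ (2 * (k + l)) := by rw [pow_mul]; positivity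
  calc ‖f x + g x‖ ≤ C * (1 + x ^ (2 * k)) + D * (1 + x ^ (2 * l)) :=
        (norm_add_le _ _).trans (add_le_add (hfb x) (hgb x))
    _ ≤ C * (2 * (1 + x ^ (2 * (k + l)))) + D * (2 * (1 + x ^ (2 * (k + l)))) := by
        gcongr <;> linarith
    _ = _ := by ring

theorem const_smul {f : ℝ → ℂ} (hf : HasPolyGrowth f) (c : ℂ) : HasPolyGrowth (c • f) := by
  obtain ⟨C, k, hC, hfb⟩ := hf.bound
  refine ⟨hf.continuous.const_smul c, ‖c‖ * C, k, by positivity, fun x => ?_⟩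
  rw [Pi.smul_apply, norm_smul, mul_assoc]
  exact mul_le_mul_of_nonneg_left (hfb x) (norm_nonneg c)

theorem sub {f g : ℝ → ℂ} (hf : HasPolyGrowth f) (hg : HasPolyGrowth g) :
    HasPolyGrowth (f - g) := by
  have := hf.add (hg.const_smul (-1))
  rwa [neg_one_smul, ← sub_eq_add_neg] at this

theorem const (c : ℂ) : HasPolyGrowth fun _ => c :=
  ⟨continuous_const, ‖c‖, 0, norm_nonneg c, fun x => by
    simp only [mul_zero, pow_zero]; nlinarith [norm_nonneg c]⟩

theorem monomialFn (n : ℕ) : HasPolyGrowth (monomialFn n) := by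
  refine ⟨(contDiff_monomialFn n).continuous, 1, n, zero_le_one, fun x => ?_⟩
  rw [_root_.monomialFn, norm_pow, Complex.norm_real, Real.norm_eq_abs, mul_comm 2 n, pow_mul,
    ← sq_abs, ← abs_pow]
  nlinarith [sq_nonneg (|x ^ n| - 1)]

theorem resolventFn {z : ℂ} (hz : z.im ≠ 0) : HasPolyGrowth (resolventFn z) := by
  refine ⟨(contDiff_resolventFn hz).continuous, 1 / |z.im|, 0, by positivity, fun x => ?_⟩
  have h : |z.im| ≤ ‖z - (x : ℂ)‖ := by simpa using Complex.abs_im_le_norm (z - (x : ℂ))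
  have h0 : 0 < |z.im| := abs_pos.2 hz
  have h1 : 1 / ‖z - (x : ℂ)‖ ≤ 1 / |z.im| := one_div_le_one_div_of_le h0 h
  have h2 : 0 < 1 / |z.im| := by positivity
  simp only [_root_.resolventFn, norm_div, norm_one, mul_zero, pow_zero]
  linarith

end HasPolyGrowth

/-! ### Linear statistics as functions of the eigenvalues -/

namespace SelfAdjointEnsemble

variable {Ω : ℕ → Type*} [∀ N, MeasurableSpace (Ω N)] (E : SelfAdjointEnsemble Ω)

theorem linStat_add (f g : ℝ → ℂ) (N : ℕ) :
    E.linStat (f + g) N = E.linStat f N + E.linStat g N := by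
  funext ω; simp [linStat, Finset.sum_add_distrib]

theorem linStat_smul (c : ℂ) (f : ℝ → ℂ) (N : ℕ) :
    E.linStat (c • f) N = c • E.linStat f N := by
  funext ω; simp [linStat, Finset.mul_sum]

theorem linStat_const (c : ℂ) (N : ℕ) : E.linStat (fun _ => c) N = fun _ => (N : ℂ) * c := by
  funext ω; simp [linStat]

theorem linStat_monomialFn (n N : ℕ) : E.linStat (monomialFn n) N = E.traceMoment N n := by
  funext ω
  exact (trace_pow_eq_sum_eigenvalues (E.isHermitian N ω) n).symm

theorem linStat_resolventFn {z : ℂ} (hz : z.im ≠ 0) (N : ℕ) :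
    E.linStat (resolventFn z) N = E.traceResolvent z N := by
  funext ω
  exact (trace_resolvent_eq_sum_eigenvalues (E.isHermitian N ω) hz).symm

theorem measurable_pow_entry (N n : ℕ) (i j : Fin N) :
    Measurable fun ω => (E.X N ω ^ n) i j := by
  induction n generalizing i j with
  | zero => simp only [pow_zero]; exact measurable_const
  | succ n ih =>
    simp only [pow_succ, Matrix.mul_apply]
    exact Finset.measurable_fun_sum _ fun k _ => (ih i k).mul (E.measurable_entry N k j)

theorem measurable_traceMoment (N n : ℕ) : Measurable (E.traceMoment N n) := by
  unfold traceMoment Matrix.trace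
  exact Finset.measurable_fun_sum _ fun k _ => E.measurable_pow_entry N n k k

theorem measurable_linStat_polynomial (p : Polynomial ℂ) (N : ℕ) :
    Measurable (E.linStat (fun x => p.eval (x : ℂ)) N) := by
  have e : E.linStat (fun x => p.eval (x : ℂ)) N =
      fun ω => ∑ i ∈ Finset.range (p.natDegree + 1), p.coeff i * E.traceMoment N i ω := by
    funext ω
    simp_rw [← linStat_monomialFn, linStat, Finset.mul_sum]
    rw [Finset.sum_comm]
    exact Finset.sum_congr rfl fun k _ => by rw [Polynomial.eval_eq_sum_range]; rfl
  rw [e]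
  exact Finset.measurable_fun_sum _ fun i _ => (E.measurable_traceMoment N i).const_mul _

/-- The eigenvalues are not known to be measurable individually, but a linear statistic is a
pointwise limit of traces of polynomials in `X_N`. -/
theorem measurable_linStat {f : ℝ → ℂ} (hf : Continuous f) (N : ℕ) :
    Measurable (E.linStat f N) := by
  have hp : ∀ n : ℕ, ∃ p : Polynomial ℂ, ∀ x ∈ Set.Icc (-(n : ℝ)) n,
      ‖p.eval (x : ℂ) - f x‖ < 1 / ((n : ℝ) + 1) := fun n =>
    exists_polynomial_near_complex _ _ hf.continuousOn Nat.one_div_pos_of_nat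
  choose p hp using hp
  refine measurable_of_tendsto_metrizable
    (fun n => E.measurable_linStat_polynomial (p n) N) (tendsto_pi_nhds.2 fun ω => ?_)
  refine tendsto_finsetSum _ fun k _ => ?_
  rw [tendsto_iff_norm_sub_tendsto_zero]
  refine squeeze_zero' (Eventually.of_forall fun n => norm_nonneg _) ?_
    (tendsto_one_div_add_atTop_nhds_zero_nat (𝕜 := ℝ))
  obtain ⟨n₀, hn₀⟩ := exists_nat_ge |(E.isHermitian N ω).eigenvalues k|
  filter_upwards [eventually_ge_atTop n₀] with n hn
  have : |(E.isHermitian N ω).eigenvalues k| ≤ n := hn₀.trans (by exact_mod_cast hn)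
  exact (hp n _ (abs_le.1 this)).le

/-- The even trace moments are nonnegative reals. -/
theorem norm_traceMoment_even (N k : ℕ) (ω : Ω N) :
    ‖E.traceMoment N (2 * k) ω‖ = ∑ i, (E.isHermitian N ω).eigenvalues i ^ (2 * k) := by
  rw [← linStat_monomialFn]
  have : E.linStat (monomialFn (2 * k)) N ω =
      ((∑ i, (E.isHermitian N ω).eigenvalues i ^ (2 * k) : ℝ) : ℂ) := by
    simp [linStat, monomialFn]
  rw [this, Complex.norm_real, Real.norm_of_nonneg]
  exact Finset.sum_nonneg fun i _ => by rw [pow_mul]; positivity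

theorem norm_linStat_le {f : ℝ → ℂ} {C : ℝ} {k : ℕ} (h : ∀ x, ‖f x‖ ≤ C * (1 + x ^ (2 * k)))
    (N : ℕ) (ω : Ω N) :
    ‖E.linStat f N ω‖ ≤ C * (N + ‖E.traceMoment N (2 * k) ω‖) := by
  rw [norm_traceMoment_even]
  refine (norm_sum_le _ _).trans ((Finset.sum_le_sum fun i _ => h _).trans (le_of_eq ?_))
  rw [← Finset.mul_sum, Finset.sum_add_distrib]
  simp

theorem memLp_linStat {P : ∀ N, Measure (Ω N)} [∀ N, IsProbabilityMeasure (P N)]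
    (hmom : ∀ N n, MemLp (E.traceMoment N n) 2 (P N)) {f : ℝ → ℂ} (hf : HasPolyGrowth f) (N : ℕ) :
    MemLp (E.linStat f N) 2 (P N) := by
  obtain ⟨C, k, hC, hfb⟩ := hf.bound
  refine MemLp.of_le (g := fun ω => C * ((N : ℝ) + ‖E.traceMoment N (2 * k) ω‖))
    (((memLp_const (N : ℝ)).add (hmom N (2 * k)).norm).const_mul C)
    (E.measurable_linStat hf.continuous N).aestronglyMeasurable (ae_of_all _ fun ω => ?_)
  rw [Real.norm_of_nonneg (by positivity)]
  exact E.norm_linStat_le hfb N ω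

end SelfAdjointEnsemble

/-! ### The tail of the spectrum -/

namespace SelfAdjointEnsemble

variable {Ω : ℕ → Type*} [∀ N, MeasurableSpace (Ω N)] {E : SelfAdjointEnsemble Ω}
  {P : ∀ N, Measure (Ω N)}

theorem NormTail.tendsto_pow_mul {M : ℝ} (h : E.NormTail P M) {j : ℕ} (hj : j ≤ 8) :
    Tendsto (fun N : ℕ => (N : ℝ) ^ j * (P N).real {ω | M < matrixOpNorm (E.X N ω)})
      atTop (𝓝 0) := by
  refine squeeze_zero' (Eventually.of_forall fun N => by positivity) ?_ h
  filter_upwards [eventually_ge_atTop 1] with N hN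
  have : (1 : ℝ) ≤ N := by exact_mod_cast hN
  gcongr

variable {a : ℕ → ℂ} {α : ℕ → ℕ → ℂ}

/-- `E |Tr(X ^ (2k))|² = O(N²)`, as the first moments converge after division by `N` and the
variances converge. -/
theorem HasMoments.tendsto_integral_sq_div (h : E.HasMoments P a α) (k : ℕ) :
    Tendsto (fun N : ℕ => (∫ ω, ‖E.traceMoment N (2 * k) ω‖ ^ 2 ∂(P N)) / (N : ℝ) ^ 3)
      atTop (𝓝 0) := by
  have hreal : ∀ N ω, E.traceMoment N (2 * k) ω = (‖E.traceMoment N (2 * k) ω‖ : ℂ) := by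
    intro N ω
    rw [norm_traceMoment_even, ← linStat_monomialFn]
    simp [linStat, monomialFn]
  have hsq : ∀ N, ∫ ω, E.traceMoment N (2 * k) ω * E.traceMoment N (2 * k) ω ∂(P N) =
      ((∫ ω, ‖E.traceMoment N (2 * k) ω‖ ^ 2 ∂(P N) : ℝ) : ℂ) := by
    intro N
    rw [← integral_complex_ofReal]
    refine integral_congr_ae (ae_of_all _ fun ω => ?_)
    simp only [Complex.ofReal_pow]
    rw [← hreal, sq]
  have hN : Tendsto (fun N : ℕ => 1 / (N : ℂ)) atTop (𝓝 0) :=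
    tendsto_one_div_atTop_nhds_zero_nat
  have hlim : Tendsto (fun N : ℕ =>
      ccov (P N) (E.traceMoment N (2 * k)) (E.traceMoment N (2 * k)) * (1 / (N : ℂ)) ^ 3 +
        ((1 / (N : ℂ)) * ∫ ω, E.traceMoment N (2 * k) ω ∂(P N)) ^ 2 * (1 / (N : ℂ)))
      atTop (𝓝 0) := by
    have := ((h.second (2 * k) (2 * k)).mul (hN.pow 3)).add (((h.first (2 * k)).pow 2).mul hN)
    simpa using this
  have hlim' := (Complex.continuous_re.tendsto _).comp hlim
  rw [Complex.zero_re] at hlim'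
  refine hlim'.congr' ?_
  filter_upwards [eventually_ge_atTop 1] with N hN1
  have hN0 : (N : ℂ) ≠ 0 := by exact_mod_cast (by omega : N ≠ 0)
  rw [Function.comp_apply, ← Complex.ofReal_re ((∫ ω, _ ∂(P N)) / (N : ℝ) ^ 3)]
  congr 1
  push_cast
  rw [← hsq, ccov]
  field_simp
  ring

variable [∀ N, IsProbabilityMeasure (P N)]

/-- A linear statistic vanishes unless `‖X_N‖ > M` when its test function vanishes on `[-M, M]`.
On that rare event `|Tr d(X)|² ≲ N² + N Tr(X ^ (4k))`, and
`N Tr(X ^ (4k)) ≤ (N⁵ + Tr(X ^ (4k))² / N³) / 2`, whose two halves are controlled by the tail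
bound and by the `O(N²)` second moment. -/
theorem HasMoments.tendsto_integral_sq_linStat_of_eqOn_zero {M : ℝ} (hA0 : E.HasMoments P a α)
    (hA1 : E.NormTail P M) {d : ℝ → ℂ} (hd : HasPolyGrowth d)
    (h0 : ∀ x ∈ Set.Icc (-M) M, d x = 0) :
    Tendsto (fun N => ∫ ω, ‖E.linStat d N ω‖ ^ 2 ∂(P N)) atTop (𝓝 0) := by
  obtain ⟨C, k, hC, hb⟩ := hd.bound
  set T : ∀ N, Ω N → ℝ := fun N ω => ‖E.traceMoment N (2 * (2 * k)) ω‖ with hT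
  set p : ℕ → ℝ := fun N => (P N).real {ω | M < matrixOpNorm (E.X N ω)} with hp
  have hlim : Tendsto (fun N : ℕ => 2 * C ^ 2 * ((N : ℝ) ^ 2 * p N +
      ((N : ℝ) ^ 5 * p N + (∫ ω, T N ω ^ 2 ∂(P N)) / (N : ℝ) ^ 3) / 2)) atTop (𝓝 0) := by
    have := ((hA1.tendsto_pow_mul (j := 2) (by norm_num)).add
      (((hA1.tendsto_pow_mul (j := 5) (by norm_num)).add
        (hA0.tendsto_integral_sq_div (2 * k))).div_const 2)).const_mul (2 * C ^ 2)
    simpa using this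
  refine squeeze_zero' (Eventually.of_forall fun N => by positivity) ?_ hlim
  filter_upwards [eventually_ge_atTop 1] with N hN1
  have hN0 : (0 : ℝ) < N := by exact_mod_cast hN1
  -- The measurable hull of the tail event spares the measurability of the operator norm.
  set A := toMeasurable (P N) {ω | M < matrixOpNorm (E.X N ω)} with hA
  have hAm : MeasurableSet A := measurableSet_toMeasurable _ _
  have hAp : (P N).real A = p N := by
    simp only [hp, hA, measureReal_def, measure_toMeasurable]
  have hT2 : Integrable (fun ω => T N ω ^ 2) (P N) :=
    (hA0.memLp N _).integrable_norm_pow (p := 2) (by norm_num)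
  set χ : Ω N → ℝ := A.indicator 1 with hχ
  have hχi : Integrable χ (P N) := (integrable_const (1 : ℝ)).indicator hAm
  have hχe : ∫ ω, χ ω ∂(P N) = p N := by rw [hχ, integral_indicator_one hAm, hAp]
  have hpt : ∀ ω, ‖E.linStat d N ω‖ ^ 2 ≤ 2 * C ^ 2 * ((N : ℝ) ^ 2 * χ ω +
      ((N : ℝ) ^ 5 * χ ω + T N ω ^ 2 / (N : ℝ) ^ 3) / 2) := by
    intro ω
    by_cases hω : ω ∈ A
    · have hχ1 : χ ω = 1 := by simp [hχ, hω]
      rw [hχ1, mul_one, mul_one]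
      set t := ‖E.traceMoment N (2 * k) ω‖ with ht
      have h1 : ‖E.linStat d N ω‖ ≤ C * (N + t) := E.norm_linStat_le hb N ω
      have h2 : t ^ 2 ≤ N * T N ω := by
        simp only [ht, hT]
        rw [norm_traceMoment_even, norm_traceMoment_even]
        have := sq_sum_le_card_mul_sum_sq (s := Finset.univ)
          (f := fun i => (E.isHermitian N ω).eigenvalues i ^ (2 * k))
        simpa [← pow_mul, mul_comm] using this
      have h3 : N * T N ω ≤ ((N : ℝ) ^ 5 + T N ω ^ 2 / (N : ℝ) ^ 3) / 2 := by
        have hs := sq_nonneg ((N : ℝ) ^ 4 - T N ω)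
        have e : ((N : ℝ) ^ 5 + T N ω ^ 2 / (N : ℝ) ^ 3) / 2 - N * T N ω =
            ((N : ℝ) ^ 4 - T N ω) ^ 2 / (2 * (N : ℝ) ^ 3) := by
          field_simp
          ring
        have : 0 ≤ ((N : ℝ) ^ 4 - T N ω) ^ 2 / (2 * (N : ℝ) ^ 3) := by positivity
        linarith
      calc ‖E.linStat d N ω‖ ^ 2 ≤ (C * (N + t)) ^ 2 := by gcongr
        _ = C ^ 2 * (N + t) ^ 2 := by ring
        _ ≤ C ^ 2 * (2 * ((N : ℝ) ^ 2 + t ^ 2)) := by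
            gcongr
            nlinarith [sq_nonneg ((N : ℝ) - t)]
        _ ≤ C ^ 2 * (2 * ((N : ℝ) ^ 2 + ((N : ℝ) ^ 5 + T N ω ^ 2 / (N : ℝ) ^ 3) / 2)) := by
            gcongr
            exact h2.trans h3
        _ = _ := by ring
    · have hχ0 : χ ω = 0 := by simp [hχ, hω]
      have hnorm : matrixOpNorm (E.X N ω) ≤ M :=
        not_lt.1 fun h => hω (subset_toMeasurable _ _ h)
      have hz : E.linStat d N ω = 0 := Finset.sum_eq_zero fun i _ =>
        h0 _ (abs_le.1 ((abs_eigenvalue_le_matrixOpNorm (E.isHermitian N ω) i).trans hnorm))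
      rw [hz, hχ0, norm_zero, zero_pow two_ne_zero]
      positivity
  have i1 : Integrable (fun ω => (N : ℝ) ^ 2 * χ ω) (P N) := hχi.const_mul _
  have i2 : Integrable (fun ω => (N : ℝ) ^ 5 * χ ω) (P N) := hχi.const_mul _
  have i3 : Integrable (fun ω => T N ω ^ 2 / (N : ℝ) ^ 3) (P N) := hT2.div_const _
  have i4 : Integrable (fun ω => ((N : ℝ) ^ 5 * χ ω + T N ω ^ 2 / (N : ℝ) ^ 3) / 2) (P N) :=
    (i2.add i3).div_const 2
  have i5 : Integrable (fun ω => (N : ℝ) ^ 2 * χ ω +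
      ((N : ℝ) ^ 5 * χ ω + T N ω ^ 2 / (N : ℝ) ^ 3) / 2) (P N) := i1.add i4
  refine (integral_mono ((E.memLp_linStat hA0.memLp hd N).integrable_norm_pow (p := 2)
    (by norm_num)) (i5.const_mul _) hpt).trans (le_of_eq ?_)
  rw [integral_const_mul, integral_add i1 i4, integral_div, integral_add i2 i3, integral_div,
    integral_const_mul, integral_const_mul, hχe]

end SelfAdjointEnsemble

/-! ### Affine extension of functions on an interval -/

section Extension

variable {M : ℝ}

/-- The primitive vanishing at `0` of the extension of `u` from `[-M, M]` to `ℝ` that is constant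
on both sides. It is affine outside `[-M, M]`, and its derivative has the same supremum as `u`. -/
noncomputable def clampPrimitive (hM : 0 < M) (u : C(Set.Icc (-M) M, ℂ)) : ℝ → ℂ := fun x =>
  ∫ t in (0 : ℝ)..x, Set.IccExtend (neg_le_self hM.le) u t

/-- The derivative of a `C¹` function, as a continuous function on `[-M, M]`. -/
noncomputable def derivOn (M : ℝ) (f : ℝ → ℂ) (hf : ContDiff ℝ 1 f) : C(Set.Icc (-M) M, ℂ) :=
  ⟨fun x => deriv f x, (contDiff_one_iff_deriv.1 hf).2.comp continuous_subtype_val⟩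

theorem continuous_iccExtend (hM : 0 < M) (u : C(Set.Icc (-M) M, ℂ)) :
    Continuous (Set.IccExtend (neg_le_self hM.le) u) :=
  u.continuous.Icc_extend'

theorem hasDerivAt_clampPrimitive (hM : 0 < M) (u : C(Set.Icc (-M) M, ℂ)) (x : ℝ) :
    HasDerivAt (clampPrimitive hM u) (Set.IccExtend (neg_le_self hM.le) u x) x :=
  ((continuous_iccExtend hM u).integral_hasStrictDerivAt 0 x).hasDerivAt

theorem deriv_clampPrimitive (hM : 0 < M) (u : C(Set.Icc (-M) M, ℂ)) :
    deriv (clampPrimitive hM u) = Set.IccExtend (neg_le_self hM.le) u :=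
  funext fun x => (hasDerivAt_clampPrimitive hM u x).deriv

theorem contDiff_clampPrimitive (hM : 0 < M) (u : C(Set.Icc (-M) M, ℂ)) :
    ContDiff ℝ 1 (clampPrimitive hM u) :=
  contDiff_one_iff_deriv.2 ⟨fun x => (hasDerivAt_clampPrimitive hM u x).differentiableAt, by
    rw [deriv_clampPrimitive]; exact continuous_iccExtend hM u⟩

theorem norm_iccExtend_le (hM : 0 < M) (u : C(Set.Icc (-M) M, ℂ)) (x : ℝ) :
    ‖Set.IccExtend (neg_le_self hM.le) u x‖ ≤ ‖u‖ :=
  u.norm_coe_le_norm _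

theorem hasPolyGrowth_clampPrimitive (hM : 0 < M) (u : C(Set.Icc (-M) M, ℂ)) :
    HasPolyGrowth (clampPrimitive hM u) := by
  refine ⟨(contDiff_clampPrimitive hM u).continuous, ‖u‖, 1, norm_nonneg u, fun x => ?_⟩
  refine (intervalIntegral.norm_integral_le_of_norm_le_const
    fun t _ => norm_iccExtend_le hM u t).trans ?_
  rw [sub_zero, mul_one, ← sq_abs]
  gcongr
  nlinarith [sq_nonneg (|x| - 1), abs_nonneg x]

theorem clampPrimitive_add (hM : 0 < M) (u v : C(Set.Icc (-M) M, ℂ)) :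
    clampPrimitive hM (u + v) = clampPrimitive hM u + clampPrimitive hM v := by
  funext x
  exact intervalIntegral.integral_add ((continuous_iccExtend hM u).intervalIntegrable _ _)
    ((continuous_iccExtend hM v).intervalIntegrable _ _)

theorem clampPrimitive_smul (hM : 0 < M) (c : ℂ) (u : C(Set.Icc (-M) M, ℂ)) :
    clampPrimitive hM (c • u) = c • clampPrimitive hM u := by
  funext x
  exact intervalIntegral.integral_smul c _

theorem eq_add_clampPrimitive_derivOn (hM : 0 < M) {f : ℝ → ℂ} (hf : ContDiff ℝ 1 f) {x : ℝ}
    (hx : x ∈ Set.Icc (-M) M) : f x = f 0 + clampPrimitive hM (derivOn M f hf) x := by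
  have hsub : Set.uIcc 0 x ⊆ Set.Icc (-M) M :=
    Set.uIcc_subset_Icc ⟨by linarith, hM.le⟩ hx
  have e : clampPrimitive hM (derivOn M f hf) x = ∫ t in (0 : ℝ)..x, deriv f t := by
    refine intervalIntegral.integral_congr fun t ht => ?_
    rw [Set.IccExtend_of_mem _ _ (hsub ht)]
    rfl
  have hd := contDiff_one_iff_deriv.1 hf
  rw [e, intervalIntegral.integral_deriv_eq_sub (fun t _ => hd.1 t)
    (hd.2.intervalIntegrable _ _)]
  ring

end Extension

/-! ### Comparison of covariances -/

namespace SelfAdjointEnsemble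

variable {Ω : ℕ → Type*} [∀ N, MeasurableSpace (Ω N)] {E : SelfAdjointEnsemble Ω}
  {P : ∀ N, Measure (Ω N)} [∀ N, IsProbabilityMeasure (P N)] {a : ℕ → ℂ} {α : ℕ → ℕ → ℂ} {M K : ℝ}

theorem Poincare.rvar_clampPrimitive_le (hA2 : E.Poincare P K) (hK : 0 < K)
    (hmom : ∀ N n, MemLp (E.traceMoment N n) 2 (P N)) (hM : 0 < M)
    (u : C(Set.Icc (-M) M, ℂ)) (N : ℕ) :
    rvar (P N) (E.linStat (clampPrimitive hM u) N) ≤ K * ‖u‖ ^ 2 := by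
  have h := hA2 _ (contDiff_clampPrimitive hM u) N
  rw [← ofReal_rvar (E.memLp_linStat hmom (hasPolyGrowth_clampPrimitive hM u) N),
    deriv_clampPrimitive] at h
  have h1 : (⨆ x, ‖Set.IccExtend (neg_le_self hM.le) u x‖ₑ) ≤ ENNReal.ofReal ‖u‖ :=
    iSup_le fun x => by
      rw [← ofReal_norm]; exact ENNReal.ofReal_le_ofReal (norm_iccExtend_le hM u x)
  have h2 : ENNReal.ofReal (rvar (P N) (E.linStat (clampPrimitive hM u) N)) ≤
      ENNReal.ofReal (K * ‖u‖ ^ 2) := by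
    rw [ENNReal.ofReal_mul hK.le, ENNReal.ofReal_pow (norm_nonneg _)]
    exact h.trans (by gcongr)
  exact (ENNReal.ofReal_le_ofReal_iff (by positivity)).1 h2

/-- A linear statistic differs from that of the clamped primitive of its derivative by a constant
and by a random variable whose second moment tends to `0`. -/
theorem HasMoments.exists_linStat_eq (hA0 : E.HasMoments P a α) (hA1 : E.NormTail P M)
    (hM : 0 < M) {f : ℝ → ℂ} (hf : ContDiff ℝ 1 f) (hfg : HasPolyGrowth f) :
    ∃ (D : ∀ N, Ω N → ℂ) (c : ℕ → ℂ), (∀ N, MemLp (D N) 2 (P N)) ∧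
      Tendsto (fun N => √(rvar (P N) (D N))) atTop (𝓝 0) ∧
      ∀ N, E.linStat f N =
        (E.linStat (clampPrimitive hM (derivOn M f hf)) N + D N) + fun _ => c N := by
  set F := clampPrimitive hM (derivOn M f hf) with hF
  have hFg : HasPolyGrowth F := hasPolyGrowth_clampPrimitive hM _
  set d : ℝ → ℂ := (f - F) - fun _ => f 0 with hd
  have hdg : HasPolyGrowth d := (hfg.sub hFg).sub (HasPolyGrowth.const _)
  have hdm : ∀ N, MemLp (E.linStat d N) 2 (P N) := E.memLp_linStat hA0.memLp hdg
  refine ⟨E.linStat d, fun N => (N : ℂ) * f 0, hdm, ?_, fun N => ?_⟩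
  · have h := hA0.tendsto_integral_sq_linStat_of_eqOn_zero hA1 hdg fun x hx => by
      simp only [hd, Pi.sub_apply, hF]
      rw [eq_add_clampPrimitive_derivOn hM hf hx]
      ring
    have h' := squeeze_zero (fun N => integral_nonneg fun ω => by positivity)
      (fun N => rvar_le_integral_sq (hdm N)) h
    rw [← Real.sqrt_zero]
    exact h'.sqrt
  · rw [← linStat_const, ← linStat_add, ← linStat_add]
    congr 1
    simp only [hd]
    abel

/-- The covariance of linear statistics depends asymptotically only on the derivatives of the test
functions on `[-M, M]`. -/
theorem HasMoments.tendsto_ccov_linStat_sub (hA0 : E.HasMoments P a α) (hA1 : E.NormTail P M)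
    (hA2 : E.Poincare P K) (hM : 0 < M) (hK : 0 < K) {f g : ℝ → ℂ} (hf : ContDiff ℝ 1 f)
    (hg : ContDiff ℝ 1 g) (hfg : HasPolyGrowth f) (hgg : HasPolyGrowth g) :
    Tendsto (fun N => ccov (P N) (E.linStat f N) (E.linStat g N) -
      ccov (P N) (E.linStat (clampPrimitive hM (derivOn M f hf)) N)
        (E.linStat (clampPrimitive hM (derivOn M g hg)) N)) atTop (𝓝 0) := by
  obtain ⟨D, c, hD, hD0, hfe⟩ := hA0.exists_linStat_eq hA1 hM hf hfg
  obtain ⟨D', c', hD', hD0', hge⟩ := hA0.exists_linStat_eq hA1 hM hg hgg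
  set u := derivOn M f hf
  set v := derivOn M g hg
  have hY : ∀ w N, MemLp (E.linStat (clampPrimitive hM w) N) 2 (P N) := fun w N =>
    E.memLp_linStat hA0.memLp (hasPolyGrowth_clampPrimitive hM w) N
  have hb : ∀ (w : C(Set.Icc (-M) M, ℂ)) N,
      √(rvar (P N) (E.linStat (clampPrimitive hM w) N)) ≤ √(K * ‖w‖ ^ 2) := fun w N =>
    Real.sqrt_le_sqrt (hA2.rvar_clampPrimitive_le hK hA0.memLp hM w N)
  have hlim : Tendsto (fun N => √(K * ‖u‖ ^ 2) * √(rvar (P N) (D' N)) +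
      √(rvar (P N) (D N)) * √(K * ‖v‖ ^ 2) + √(rvar (P N) (D N)) * √(rvar (P N) (D' N)))
      atTop (𝓝 0) := by
    simpa only [mul_zero, zero_mul, add_zero] using
      ((hD0'.const_mul (√(K * ‖u‖ ^ 2))).add (hD0.mul_const (√(K * ‖v‖ ^ 2)))).add (hD0.mul hD0')
  refine squeeze_zero_norm (fun N => ?_) hlim
  have e : ccov (P N) (E.linStat f N) (E.linStat g N) -
      ccov (P N) (E.linStat (clampPrimitive hM u) N) (E.linStat (clampPrimitive hM v) N) =
      ccov (P N) (E.linStat (clampPrimitive hM u) N) (D' N) +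
      ccov (P N) (D N) (E.linStat (clampPrimitive hM v) N) + ccov (P N) (D N) (D' N) := by
    rw [hfe, hge, ccov_add_left ((hY u N).add (hD N)) (memLp_const _)
      (((hY v N).add (hD' N)).add (memLp_const _)), ccov_const_left,
      ccov_add_right ((hY u N).add (hD N)) ((hY v N).add (hD' N)) (memLp_const _),
      ccov_const_right, ccov_add_left (hY u N) (hD N) ((hY v N).add (hD' N)),
      ccov_add_right (hY u N) (hY v N) (hD' N), ccov_add_right (hD N) (hY v N) (hD' N)]
    ring
  rw [e]
  refine (norm_add₃_le).trans (add_le_add_three ?_ ?_ (norm_ccov_le (hD N) (hD' N)))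
  · exact (norm_ccov_le (hY u N) (hD' N)).trans
      (mul_le_mul_of_nonneg_right (hb u N) (Real.sqrt_nonneg _))
  · exact (norm_ccov_le (hD N) (hY v N)).trans (mul_le_mul_of_nonneg_left (hb v N) (Real.sqrt_nonneg _))

end SelfAdjointEnsemble

/-! ### Limits of bounded bilinear functionals -/

section BilinearLimit

variable {V : Type*} [NormedAddCommGroup V] [NormedSpace ℂ V]

/-- Uniformly bounded functionals that converge on a set with dense span converge everywhere. -/
theorem exists_tendsto_of_dense_span {L : ℕ → V →ₗ[ℂ] ℂ} {C : ℝ} (hL : ∀ N v, ‖L N v‖ ≤ C * ‖v‖)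
    {s : Set V} (hs : Dense (Submodule.span ℂ s : Set V))
    (hconv : ∀ v ∈ s, ∃ l, Tendsto (fun N => L N v) atTop (𝓝 l)) (v : V) :
    ∃ l, Tendsto (fun N => L N v) atTop (𝓝 l) := by
  have hspan : ∀ w ∈ Submodule.span ℂ s, ∃ l, Tendsto (fun N => L N w) atTop (𝓝 l) := by
    intro w hw
    induction hw using Submodule.span_induction with
    | mem x hx => exact hconv x hx
    | zero => exact ⟨0, by simp⟩
    | add x y _ _ hx hy =>
      obtain ⟨l, hl⟩ := hx
      obtain ⟨m, hm⟩ := hy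
      exact ⟨l + m, by simpa using hl.add hm⟩
    | smul c x _ hx =>
      obtain ⟨l, hl⟩ := hx
      exact ⟨c * l, by simpa using hl.const_mul c⟩
  have hC : ∀ N v, ‖L N v‖ ≤ (|C| + 1) * ‖v‖ := fun N v => (hL N v).trans
    (mul_le_mul_of_nonneg_right ((le_abs_self C).trans (by linarith)) (norm_nonneg v))
  refine cauchySeq_tendsto_of_complete (Metric.cauchySeq_iff'.2 fun ε hε => ?_)
  have hC0 : 0 < |C| + 1 := by positivity
  obtain ⟨w, hw, hvw⟩ := hs.exists_dist_lt v (show 0 < ε / 3 / (|C| + 1) by positivity)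
  have hd : ∀ N, dist (L N v) (L N w) < ε / 3 := fun N => by
    rw [dist_eq_norm, ← map_sub]
    refine (hC N _).trans_lt ?_
    rw [dist_eq_norm, lt_div_iff₀ hC0] at hvw
    linarith
  obtain ⟨l, hl⟩ := hspan w hw
  obtain ⟨N, hN⟩ := Metric.cauchySeq_iff'.1 hl.cauchySeq (ε / 3) (by positivity)
  refine ⟨N, fun n hn => ?_⟩
  have h1 := dist_triangle4 (L n v) (L n w) (L N w) (L N v)
  have h2 := hN n hn
  have h3 := hd n
  have h4 := hd N
  rw [dist_comm] at h4
  linarith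

/-- Uniformly bounded bilinear functionals that converge on a set with dense span converge to a
bilinear functional with the same bound. -/
theorem exists_bilinear_limit {b : ℕ → V →ₗ[ℂ] V →ₗ[ℂ] ℂ} {K : ℝ}
    (hb : ∀ N u v, ‖b N u v‖ ≤ K * ‖u‖ * ‖v‖) {s : Set V}
    (hs : Dense (Submodule.span ℂ s : Set V))
    (hconv : ∀ u ∈ s, ∀ v ∈ s, ∃ l, Tendsto (fun N => b N u v) atTop (𝓝 l)) :
    ∃ B : V →L[ℂ] V →L[ℂ] ℂ, (∀ u v, Tendsto (fun N => b N u v) atTop (𝓝 (B u v))) ∧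
      ∀ u v, ‖B u v‖ ≤ K * ‖u‖ * ‖v‖ := by
  have h1 : ∀ u ∈ s, ∀ v, ∃ l, Tendsto (fun N => b N u v) atTop (𝓝 l) := fun u hu =>
    exists_tendsto_of_dense_span (L := fun N => b N u) (fun N v => hb N u v) hs (hconv u hu)
  have h2 : ∀ u v, ∃ l, Tendsto (fun N => b N u v) atTop (𝓝 l) := fun u v =>
    exists_tendsto_of_dense_span (L := fun N => (b N).flip v) (C := K * ‖v‖)
      (fun N u => (hb N u v).trans (le_of_eq (by ring))) hs (fun u hu => h1 u hu v) u
  choose β hβ using h2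
  have hbound : ∀ u v, ‖β u v‖ ≤ K * ‖u‖ * ‖v‖ := fun u v =>
    le_of_tendsto (hβ u v).norm (Eventually.of_forall fun N => hb N u v)
  let B₀ : V →ₗ[ℂ] V →ₗ[ℂ] ℂ := LinearMap.mk₂ ℂ β
    (fun u u' v => tendsto_nhds_unique (hβ _ _) (by simpa using (hβ u v).add (hβ u' v)))
    (fun c u v => tendsto_nhds_unique (hβ _ _) (by simpa using (hβ u v).const_mul c))
    (fun u v v' => tendsto_nhds_unique (hβ _ _) (by simpa using (hβ u v).add (hβ u v')))
    (fun c u v => tendsto_nhds_unique (hβ _ _) (by simpa using (hβ u v).const_mul c))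
  exact ⟨B₀.mkContinuous₂ K hbound, hβ, hbound⟩

end BilinearLimit

/-! ### Differentiation on the interval and density of polynomials -/

section Derivative

variable {M : ℝ}

/-- The coordinate function on `[-M, M]`. -/
def coordOn (M : ℝ) : C(Set.Icc (-M) M, ℂ) :=
  ⟨fun x => ((x : ℝ) : ℂ), Complex.continuous_ofReal.comp continuous_subtype_val⟩

theorem derivOn_monomialFn (M : ℝ) (n : ℕ) :
    derivOn M (monomialFn n) (contDiff_monomialFn n) = (n : ℂ) • coordOn M ^ (n - 1) := by
  ext x
  have h : HasDerivAt (monomialFn n) ((n : ℂ) * ((x : ℝ) : ℂ) ^ (n - 1) * 1) (x : ℝ) :=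
    (Complex.ofRealCLM.hasDerivAt (x := (x : ℝ))).pow n
  simpa [derivOn, coordOn] using h.deriv

theorem dense_span_derivOn_monomialFn (M : ℝ) :
    Dense (Submodule.span ℂ (Set.range fun n : ℕ =>
      derivOn M (monomialFn n) (contDiff_monomialFn n)) : Set C(Set.Icc (-M) M, ℂ)) := by
  refine Metric.dense_iff.2 fun u ε hε => ?_
  by_cases hM : -M ≤ M
  · obtain ⟨p, hp⟩ := exists_polynomial_near_complex (-M) M (f := Set.IccExtend hM u)
      u.continuous.Icc_extend'.continuousOn (half_pos hε)
    have hval : ∀ x : Set.Icc (-M) M,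
        Polynomial.aeval (coordOn M) p x = p.eval ((x : ℝ) : ℂ) := fun x => by
      simp [Polynomial.aeval_eq_sum_range, Polynomial.eval_eq_sum_range, coordOn,
        ContinuousMap.sum_apply]
    refine ⟨Polynomial.aeval (coordOn M) p, ?_, ?_⟩
    · rw [Metric.mem_ball, dist_eq_norm]
      refine lt_of_le_of_lt ((ContinuousMap.norm_le _ (half_pos hε).le).2 fun x => ?_)
        (half_lt_self hε)
      have := hp x x.2
      rw [Set.IccExtend_of_mem _ _ x.2] at this
      rw [ContinuousMap.sub_apply, hval]
      exact this.le
    · rw [Polynomial.aeval_eq_sum_range]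
      refine Submodule.sum_mem _ fun i _ => Submodule.smul_mem _ _ ?_
      have e : coordOn M ^ i =
          ((i : ℂ) + 1)⁻¹ • derivOn M (monomialFn (i + 1)) (contDiff_monomialFn (i + 1)) := by
        rw [derivOn_monomialFn, smul_smul, Nat.cast_add, Nat.cast_one,
          inv_mul_cancel₀ (Nat.cast_add_one_ne_zero i), one_smul, Nat.add_sub_cancel]
      rw [e]
      exact Submodule.smul_mem _ _ (Submodule.subset_span ⟨i + 1, rfl⟩)
  · have : IsEmpty (Set.Icc (-M) M) := ⟨fun x => hM (x.2.1.trans x.2.2)⟩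
    exact ⟨0, by rw [Subsingleton.elim u 0]; exact Metric.mem_ball_self hε,
      Submodule.zero_mem _⟩

theorem derivOn_congr (hM : 0 < M) {f g : ℝ → ℂ} (hf : ContDiff ℝ 1 f) (hg : ContDiff ℝ 1 g)
    (h : (Set.Icc (-M) M).domRestrict f = (Set.Icc (-M) M).domRestrict g) :
    derivOn M f hf = derivOn M g hg := by
  ext x
  have hu : UniqueDiffWithinAt ℝ (Set.Icc (-M) M) (x : ℝ) :=
    uniqueDiffOn_Icc (by linarith) x x.2
  have hfg : Set.EqOn f g (Set.Icc (-M) M) := fun y hy => congrFun h ⟨y, hy⟩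
  change deriv f x = deriv g x
  rw [← ((contDiff_one_iff_deriv.1 hf).1 x).derivWithin hu,
    ← ((contDiff_one_iff_deriv.1 hg).1 x).derivWithin hu]
  exact derivWithin_congr hfg (hfg x.2)

theorem derivOn_add {f g : ℝ → ℂ} (hf : ContDiff ℝ 1 f) (hg : ContDiff ℝ 1 g) :
    derivOn M (f + g) (hf.add hg) = derivOn M f hf + derivOn M g hg := by
  ext x
  exact deriv_add ((contDiff_one_iff_deriv.1 hf).1 x) ((contDiff_one_iff_deriv.1 hg).1 x)

theorem derivOn_smul (c : ℂ) {f : ℝ → ℂ} (hf : ContDiff ℝ 1 f) :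
    derivOn M (c • f) (contDiff_const.smul hf) = c • derivOn M f hf := by
  ext x
  exact deriv_const_smul_field c f

/-- Differentiation `C¹([-M, M]) → C([-M, M])`. An element of `C¹([-M, M])` determines the derivative
of any of its `C¹` extensions on `[-M, M]`, as this interval is not degenerate. -/
noncomputable def derivC1 (hM : 0 < M) : C1On M →ₗ[ℂ] C(Set.Icc (-M) M, ℂ) where
  toFun h := derivOn M h.2.choose h.2.choose_spec.1
  map_add' h k := by
    rw [← derivOn_add]
    refine derivOn_congr hM _ _ ?_
    rw [(h + k).2.choose_spec.2]
    exact (congrArg₂ (· + ·) h.2.choose_spec.2 k.2.choose_spec.2).symm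
  map_smul' c h := by
    rw [RingHom.id_apply, ← derivOn_smul]
    refine derivOn_congr hM _ _ ?_
    rw [(c • h).2.choose_spec.2]
    exact (congrArg (c • ·) h.2.choose_spec.2).symm

theorem derivC1_restrC1 (hM : 0 < M) {f : ℝ → ℂ} (hf : ContDiff ℝ 1 f) :
    derivC1 hM (restrC1 M f hf) = derivOn M f hf :=
  derivOn_congr hM (restrC1 M f hf).2.choose_spec.1 hf (restrC1 M f hf).2.choose_spec.2

theorem norm_derivOn {f : ℝ → ℂ} (hf : ContDiff ℝ 1 f) :
    ‖derivOn M f hf‖ = ⨆ x : Set.Icc (-M) M, ‖deriv f x‖ :=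
  ContinuousMap.norm_eq_iSup_norm _

/-- A functional bounded by the supremum of the derivative is determined by its values on
monomials: the derivatives of polynomials are dense, and constants are in its kernel. -/
theorem eq_zero_of_monomialFn_eq_zero (hM : 0 < M) {L : C1On M →ₗ[ℂ] ℂ} {C : ℝ}
    (hL : ∀ h, ‖L h‖ ≤ C * ‖derivC1 hM h‖)
    (h0 : ∀ n, L (restrC1 M (monomialFn n) (contDiff_monomialFn n)) = 0) (h : C1On M) :
    L h = 0 := by
  have hC : ∀ h, ‖L h‖ ≤ (|C| + 1) * ‖derivC1 hM h‖ := fun h => (hL h).trans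
    (mul_le_mul_of_nonneg_right ((le_abs_self C).trans (by linarith)) (norm_nonneg _))
  have hC0 : 0 < |C| + 1 := by positivity
  have hrange : ∀ w ∈ Submodule.span ℂ (Set.range fun n : ℕ =>
      derivOn M (monomialFn n) (contDiff_monomialFn n)),
      ∃ k : C1On M, derivC1 hM k = w ∧ L k = 0 := by
    intro w hw
    induction hw using Submodule.span_induction with
    | mem x hx =>
      obtain ⟨n, rfl⟩ := hx
      exact ⟨_, derivC1_restrC1 hM (contDiff_monomialFn n), h0 n⟩
    | zero => exact ⟨0, map_zero _, map_zero _⟩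
    | add x y _ _ hx hy =>
      obtain ⟨k, rfl, hk⟩ := hx
      obtain ⟨l, rfl, hl⟩ := hy
      exact ⟨k + l, map_add _ _ _, by rw [map_add, hk, hl, add_zero]⟩
    | smul c x _ hx =>
      obtain ⟨k, rfl, hk⟩ := hx
      exact ⟨c • k, map_smul _ _ _, by rw [map_smul, hk, smul_zero]⟩
  refine norm_le_zero_iff.1 (le_of_forall_pos_lt_add fun ε hε => ?_)
  obtain ⟨w, hw, hlt⟩ := (dense_span_derivOn_monomialFn M).exists_dist_lt (derivC1 hM h)
    (show 0 < ε / (|C| + 1) by positivity)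
  obtain ⟨k, rfl, hk⟩ := hrange w hw
  have h1 := hC (h - k)
  rw [map_sub, hk, sub_zero, map_sub, ← dist_eq_norm] at h1
  rw [lt_div_iff₀ hC0] at hlt
  linarith

end Derivative

theorem IsBoundedExtension.norm_le {α : ℕ → ℕ → ℂ} {M C : ℝ} (hM : 0 < M)
    {τ : C1On M →ₗ[ℂ] C1On M →ₗ[ℂ] ℂ} (hτ : IsBoundedExtension α M C τ) (h k : C1On M) :
    ‖τ h k‖ ≤ C * ‖derivC1 hM h‖ * ‖derivC1 hM k‖ := by
  obtain ⟨_, f, hf, rfl⟩ := h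
  obtain ⟨_, g, hg, rfl⟩ := k
  have := hτ.bound f g hf hg
  rw [← norm_derivOn hf, ← norm_derivOn hg, ← derivC1_restrC1 hM hf,
    ← derivC1_restrC1 hM hg] at this
  exact this

theorem IsBoundedExtension.eq {α : ℕ → ℕ → ℂ} {M C C' : ℝ} (hM : 0 < M)
    {τ ρ : C1On M →ₗ[ℂ] C1On M →ₗ[ℂ] ℂ} (hτ : IsBoundedExtension α M C τ)
    (hρ : IsBoundedExtension α M C' ρ) : τ = ρ := by
  have hb : ∀ h k, ‖(τ - ρ) h k‖ ≤ (C + C') * ‖derivC1 hM h‖ * ‖derivC1 hM k‖ := fun h k => by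
    have h1 := hτ.norm_le hM h k
    have h2 := hρ.norm_le hM h k
    refine (norm_sub_le _ _).trans ((add_le_add h1 h2).trans (le_of_eq (by ring)))
  have h1 : ∀ m k, (τ - ρ) (restrC1 M (monomialFn m) (contDiff_monomialFn m)) k = 0 := fun m =>
    eq_zero_of_monomialFn_eq_zero hM (hb _) fun n => by
      rw [LinearMap.sub_apply, LinearMap.sub_apply, hτ.monomial, hρ.monomial, sub_self]
  refine sub_eq_zero.1 (LinearMap.ext₂ fun h k => ?_)
  exact eq_zero_of_monomialFn_eq_zero hM (L := (τ - ρ).flip k) (C := (C + C') * ‖derivC1 hM k‖)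
    (fun h => (hb h k).trans (le_of_eq (by ring))) (fun m => h1 m k) h

/-! ### Convergence of covariances of linear statistics -/

namespace SelfAdjointEnsemble

variable {Ω : ℕ → Type*} [∀ N, MeasurableSpace (Ω N)] {E : SelfAdjointEnsemble Ω}
  {P : ∀ N, Measure (Ω N)} [∀ N, IsProbabilityMeasure (P N)] {a : ℕ → ℂ} {α : ℕ → ℕ → ℂ} {M K : ℝ}

/-- The covariances of linear statistics converge, for all `C¹` test functions of polynomial growth,
to a bounded bilinear functional of the derivatives on `[-M, M]`. -/
theorem HasMoments.exists_bilinear_limit_ccov (hA0 : E.HasMoments P a α) (hA1 : E.NormTail P M)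
    (hA2 : E.Poincare P K) (hM : 0 < M) (hK : 0 < K) :
    ∃ B : C(Set.Icc (-M) M, ℂ) →L[ℂ] C(Set.Icc (-M) M, ℂ) →L[ℂ] ℂ,
      (∀ u v, ‖B u v‖ ≤ K * ‖u‖ * ‖v‖) ∧
      ∀ (f g : ℝ → ℂ) (hf : ContDiff ℝ 1 f) (hg : ContDiff ℝ 1 g), HasPolyGrowth f →
        HasPolyGrowth g → Tendsto (fun N => ccov (P N) (E.linStat f N) (E.linStat g N)) atTop
          (𝓝 (B (derivOn M f hf) (derivOn M g hg))) := by
  have hY : ∀ (w : C(Set.Icc (-M) M, ℂ)) N, MemLp (E.linStat (clampPrimitive hM w) N) 2 (P N) :=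
    fun w N => E.memLp_linStat hA0.memLp (hasPolyGrowth_clampPrimitive hM w) N
  let b : ℕ → C(Set.Icc (-M) M, ℂ) →ₗ[ℂ] C(Set.Icc (-M) M, ℂ) →ₗ[ℂ] ℂ := fun N =>
    LinearMap.mk₂ ℂ (fun u v => ccov (P N) (E.linStat (clampPrimitive hM u) N)
      (E.linStat (clampPrimitive hM v) N))
      (fun u u' v => by
        rw [clampPrimitive_add, linStat_add, ccov_add_left (hY u N) (hY u' N) (hY v N)])
      (fun c u v => by rw [clampPrimitive_smul, linStat_smul, ccov_smul_left, smul_eq_mul])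
      (fun u v v' => by
        rw [clampPrimitive_add, linStat_add, ccov_add_right (hY u N) (hY v N) (hY v' N)])
      (fun c u v => by rw [clampPrimitive_smul, linStat_smul, ccov_smul_right, smul_eq_mul])
  have hb : ∀ N u v, ‖b N u v‖ ≤ K * ‖u‖ * ‖v‖ := fun N u v => by
    have h := fun w => Real.sqrt_le_sqrt (hA2.rvar_clampPrimitive_le hK hA0.memLp hM w N)
    have hs := Real.mul_self_sqrt hK.le
    calc ‖b N u v‖ ≤ √(K * ‖u‖ ^ 2) * √(K * ‖v‖ ^ 2) :=
          (norm_ccov_le (hY u N) (hY v N)).trans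
            (mul_le_mul (h u) (h v) (Real.sqrt_nonneg _) (Real.sqrt_nonneg _))
      _ = (√K * √K) * ‖u‖ * ‖v‖ := by
          rw [Real.sqrt_mul hK.le, Real.sqrt_mul hK.le, Real.sqrt_sq (norm_nonneg u),
            Real.sqrt_sq (norm_nonneg v)]
          ring
      _ = _ := by rw [hs]
  have hcomp : ∀ (f g : ℝ → ℂ) (hf : ContDiff ℝ 1 f) (hg : ContDiff ℝ 1 g), HasPolyGrowth f →
      HasPolyGrowth g → Tendsto (fun N => ccov (P N) (E.linStat f N) (E.linStat g N) -
        b N (derivOn M f hf) (derivOn M g hg)) atTop (𝓝 0) := fun f g hf hg hfg hgg =>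
    hA0.tendsto_ccov_linStat_sub hA1 hA2 hM hK hf hg hfg hgg
  obtain ⟨B, hB, hBK⟩ := exists_bilinear_limit hb (dense_span_derivOn_monomialFn M) (by
    rintro _ ⟨m, rfl⟩ _ ⟨n, rfl⟩
    refine ⟨α m n, ?_⟩
    have h := (hA0.second m n).sub (hcomp _ _ (contDiff_monomialFn m) (contDiff_monomialFn n)
      (HasPolyGrowth.monomialFn m) (HasPolyGrowth.monomialFn n))
    simpa [linStat_monomialFn] using h)
  refine ⟨B, hBK, fun f g hf hg hfg hgg => ?_⟩
  simpa using (hcomp f g hf hg hfg hgg).add (hB (derivOn M f hf) (derivOn M g hg))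

end SelfAdjointEnsemble

/-! ### Inverses on the interval and their expansion -/

section Cauchy

variable {M : ℝ}

/-- The inverse of `z - x` in the Banach algebra `C([-M, M])`, which exists for `z` off `[-M, M]`. For
real `z` outside `[-M, M]` it exists although `r_z` has a pole on the line; on `[-M, M]` it takes the
default value `0` of `Ring.inverse`. -/
noncomputable def resolventOn (M : ℝ) (z : ℂ) : C(Set.Icc (-M) M, ℂ) :=
  Ring.inverse (algebraMap ℂ C(Set.Icc (-M) M, ℂ) z - coordOn M)

theorem isUnit_sub_coordOn {z : ℂ} (hz : z ∈ cutPlane M) :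
    IsUnit (algebraMap ℂ C(Set.Icc (-M) M, ℂ) z - coordOn M) := by
  rw [ContinuousMap.isUnit_iff_forall_isUnit]
  intro x
  rw [isUnit_iff_ne_zero]
  intro h
  refine hz ⟨x, x.2, ?_⟩
  have h' : z - ((x : ℝ) : ℂ) = 0 := by simpa [coordOn] using h
  exact (sub_eq_zero.1 h').symm

theorem resolventOn_apply {z : ℂ} (hz : z ∈ cutPlane M) (x : Set.Icc (-M) M) :
    resolventOn M z x = (z - ((x : ℝ) : ℂ))⁻¹ := by
  have h := congrArg (fun u : C(Set.Icc (-M) M, ℂ) => u x)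
    (Ring.inverse_mul_cancel _ (isUnit_sub_coordOn hz))
  have h' : resolventOn M z x * (z - ((x : ℝ) : ℂ)) = 1 := by
    simpa [coordOn, resolventOn] using h
  exact eq_inv_of_mul_eq_one_left h'

theorem analyticAt_resolventOn {z : ℂ} (hz : z ∈ cutPlane M) :
    AnalyticAt ℂ (resolventOn M) z := by
  obtain ⟨u, hu⟩ := isUnit_sub_coordOn hz
  have h1 : AnalyticAt ℂ (fun z => algebraMap ℂ C(Set.Icc (-M) M, ℂ) z - coordOn M) z :=
    ((Algebra.linearMap ℂ C(Set.Icc (-M) M, ℂ)).toContinuousLinearMap.analyticAt z).sub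
      analyticAt_const
  have h2 : AnalyticAt ℂ Ring.inverse (algebraMap ℂ C(Set.Icc (-M) M, ℂ) z - coordOn M) :=
    hu ▸ analyticAt_inverse u
  exact AnalyticAt.comp (g := Ring.inverse)
    (f := fun z => algebraMap ℂ C(Set.Icc (-M) M, ℂ) z - coordOn M) h2 h1

theorem mem_cutPlane_of_im_ne_zero {z : ℂ} (hz : z.im ≠ 0) : z ∈ cutPlane M := by
  rintro ⟨x, _, rfl⟩
  exact hz (Complex.ofReal_im x)

theorem mem_cutPlane_of_lt_norm {z : ℂ} (hz : M < ‖z‖) : z ∈ cutPlane M := by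
  rintro ⟨x, hx, rfl⟩
  rw [Complex.norm_real, Real.norm_eq_abs] at hz
  exact absurd (abs_le.2 hx) (not_le.2 hz)

theorem derivOn_resolventFn {z : ℂ} (hz : z.im ≠ 0) :
    derivOn M (resolventFn z) (contDiff_resolventFn hz) = resolventOn M z ^ 2 := by
  ext x
  have hne : z - ((x : ℝ) : ℂ) ≠ 0 := fun h => hz (by simpa using congrArg Complex.im h)
  have h : HasDerivAt (fun y : ℝ => (z - (y : ℂ))⁻¹) (-(-1) / (z - ((x : ℝ) : ℂ)) ^ 2) (x : ℝ) :=
    ((Complex.ofRealCLM.hasDerivAt (x := (x : ℝ))).const_sub z).inv hne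
  have e : resolventFn z = fun y : ℝ => (z - (y : ℂ))⁻¹ := funext fun y => one_div _
  rw [ContinuousMap.pow_apply, resolventOn_apply (mem_cutPlane_of_im_ne_zero hz)]
  change deriv (resolventFn z) x = _
  rw [e, h.deriv, neg_neg, one_div, inv_pow]

/-- The terms of the expansion of `1 / (z - x)²` for `|z| > M`. -/
noncomputable def resolventTerm (M : ℝ) (z : ℂ) (n : ℕ) : C(Set.Icc (-M) M, ℂ) :=
  (z ^ (n + 1))⁻¹ • derivOn M (monomialFn n) (contDiff_monomialFn n)

theorem resolventTerm_zero (M : ℝ) (z : ℂ) : resolventTerm M z 0 = 0 := by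
  ext x
  rw [resolventTerm, derivOn_monomialFn]
  simp

theorem summable_norm_resolventTerm (hM : 0 < M) {z : ℂ} (hz : M < ‖z‖) :
    Summable fun n => ‖resolventTerm M z n‖ := by
  have hz0 : 0 < ‖z‖ := hM.trans hz
  have hq : ‖M / ‖z‖‖ < 1 := by
    rw [Real.norm_of_nonneg (by positivity)]
    exact (div_lt_one hz0).2 hz
  have hs := ((summable_pow_mul_geometric_of_norm_lt_one 1 hq).mul_left (1 / (M * ‖z‖)))
  refine Summable.of_nonneg_of_le (fun n => norm_nonneg _) (fun n => ?_) hs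
  have hX : ‖coordOn M ^ (n - 1)‖ ≤ M ^ (n - 1) := by
    refine (ContinuousMap.norm_le _ (by positivity)).2 fun x => ?_
    rw [ContinuousMap.pow_apply, norm_pow]
    refine pow_le_pow_left₀ (norm_nonneg _) ?_ _
    change ‖((x : ℝ) : ℂ)‖ ≤ M
    rw [Complex.norm_real]
    exact abs_le.2 x.2
  rw [resolventTerm, derivOn_monomialFn, norm_smul, norm_smul, norm_inv, norm_pow,
    Complex.norm_natCast]
  rcases n with _ | n
  · simp
  · calc (‖z‖ ^ (n + 1 + 1))⁻¹ * (((n + 1 : ℕ) : ℝ) * ‖coordOn M ^ (n + 1 - 1)‖)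
        ≤ (‖z‖ ^ (n + 1 + 1))⁻¹ * (((n + 1 : ℕ) : ℝ) * M ^ (n + 1 - 1)) := by gcongr
      _ = _ := by
        rw [Nat.add_sub_cancel, div_pow]
        field_simp
        ring

theorem tsum_resolventTerm (hM : 0 < M) {z : ℂ} (hz : M < ‖z‖) :
    ∑' n, resolventTerm M z n = resolventOn M z ^ 2 := by
  have hsum := (summable_norm_resolventTerm hM hz).of_norm
  ext x
  have hz0 : z ≠ 0 := norm_pos_iff.1 (hM.trans hz)
  have hx : ‖((x : ℝ) : ℂ) / z‖ < 1 := by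
    rw [norm_div, Complex.norm_real, div_lt_one (hM.trans hz)]
    exact (abs_le.2 x.2).trans_lt hz
  have hxz : z - ((x : ℝ) : ℂ) ≠ 0 := fun h =>
    mem_cutPlane_of_lt_norm hz ⟨x, x.2, (sub_eq_zero.1 h).symm⟩
  rw [← ContinuousMap.tsum_apply hsum x, ContinuousMap.pow_apply,
    resolventOn_apply (mem_cutPlane_of_lt_norm hz)]
  have hterm : ∀ n, resolventTerm M z (n + 1) x =
      (1 / z ^ 2) * (((n + 1).choose 1 : ℂ) * (((x : ℝ) : ℂ) / z) ^ n) := fun n => by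
    rw [resolventTerm, derivOn_monomialFn]
    simp only [ContinuousMap.smul_apply, ContinuousMap.pow_apply, coordOn, ContinuousMap.coe_mk,
      Nat.choose_one_right, smul_eq_mul, Nat.add_sub_cancel, div_pow]
    field_simp
    ring
  have hgeo := (hasSum_choose_mul_geometric_of_norm_lt_one 1 hx).mul_left (1 / z ^ 2)
  have h0 : resolventTerm M z 0 x = 0 := by rw [resolventTerm_zero]; rfl
  have hs : HasSum (fun n => resolventTerm M z n x)
      (1 / z ^ 2 * (1 / (1 - ((x : ℝ) : ℂ) / z) ^ (1 + 1))) := by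
    rw [← hasSum_nat_add_iff' 1]
    simpa [h0, hterm] using hgeo
  rw [hs.tsum_eq]
  have e : 1 - ((x : ℝ) : ℂ) / z = (z - x) / z := by field_simp
  rw [e, div_pow]
  field_simp
  ring

/-- Expanding `1 / (z - x)²` and `1 / (w - x)²` in a bounded bilinear functional `B` of the
derivatives yields the second-order Cauchy transform of the moments of `B`. -/
theorem summable_cauchyTerm_and_tsum {α : ℕ → ℕ → ℂ}
    {B : C(Set.Icc (-M) M, ℂ) →L[ℂ] C(Set.Icc (-M) M, ℂ) →L[ℂ] ℂ}
    (hB : ∀ m n, B (derivOn M (monomialFn m) (contDiff_monomialFn m))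
      (derivOn M (monomialFn n) (contDiff_monomialFn n)) = α m n)
    {K : ℝ} (hBK : ∀ u v, ‖B u v‖ ≤ K * ‖u‖ * ‖v‖) (hM : 0 < M) {z w : ℂ}
    (hz : M < ‖z‖) (hw : M < ‖w‖) :
    Summable (cauchyTerm α z w) ∧
      B (resolventOn M z ^ 2) (resolventOn M w ^ 2) = secondOrderCauchy α z w := by
  set F : ℕ × ℕ → ℂ := fun p => B (resolventTerm M z p.1) (resolventTerm M w p.2) with hF
  set ι : ℕ+ × ℕ+ → ℕ × ℕ := Prod.map (fun n => (n : ℕ)) (fun n => (n : ℕ)) with hι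
  have hι_inj : Function.Injective ι := PNat.coe_injective.prodMap PNat.coe_injective
  have hterm : cauchyTerm α z w = F ∘ ι := by
    funext p
    simp only [hF, hι, Function.comp_apply, Prod.map_fst, Prod.map_snd, resolventTerm, map_smul,
      smul_apply, hB, cauchyTerm, smul_eq_mul]
    rw [div_eq_mul_inv, mul_inv]
    ring
  have hsz := summable_norm_resolventTerm hM hz
  have hsw := summable_norm_resolventTerm hM hw
  have hFs : Summable F := by
    refine Summable.of_norm_bounded (g := fun p : ℕ × ℕ =>
      K * (‖resolventTerm M z p.1‖ * ‖resolventTerm M w p.2‖))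
      ((hsz.mul_of_nonneg hsw (fun _ => norm_nonneg _) fun _ => norm_nonneg _).mul_left _)
      fun p => ?_
    rw [← mul_assoc]
    exact hBK _ _
  have hsupp : Function.support F ⊆ Set.range ι := by
    rintro ⟨m, n⟩ hmn
    have hm : m ≠ 0 := fun h => hmn (by simp [hF, h, resolventTerm_zero])
    have hn : n ≠ 0 := fun h => hmn (by simp [hF, h, resolventTerm_zero])
    exact ⟨(⟨m, Nat.pos_of_ne_zero hm⟩, ⟨n, Nat.pos_of_ne_zero hn⟩), rfl⟩
  refine ⟨hterm ▸ hFs.comp_injective hι_inj, ?_⟩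
  rw [secondOrderCauchy, hterm]
  simp only [Function.comp_apply]
  rw [hι_inj.tsum_eq hsupp, hFs.tsum_prod, ← tsum_resolventTerm hM hz,
    B.map_tsum hsz.of_norm, ← tsum_resolventTerm hM hw]
  have happ := ((ContinuousLinearMap.apply ℂ ℂ (∑' n, resolventTerm M w n))).map_tsum
    (hsz.of_norm.map B B.continuous)
  simp only [ContinuousLinearMap.apply_apply, Function.comp_apply] at happ
  rw [happ]
  exact tsum_congr fun m => (B _).map_tsum hsw.of_norm

end Cauchy

/-! ### The second-order moment functional and the transform -/

theorem theorem3p4 {Ω : ℕ → Type*} [∀ N, MeasurableSpace (Ω N)]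
    (P : ∀ N, Measure (Ω N)) [∀ N, IsProbabilityMeasure (P N)]
    (E : SelfAdjointEnsemble Ω)
    (a : ℕ → ℂ) (α : ℕ → ℕ → ℂ) (M K : ℝ) (hM : 0 < M) (hK : 0 < K)
    (hA0 : E.HasMoments P a α) (hA1 : E.NormTail P M) (hA2 : E.Poincare P K) :
    ∃ ρ : C1On M →ₗ[ℂ] C1On M →ₗ[ℂ] ℂ,
      -- the functional extending the second-order moments exists and is unique
      IsBoundedExtension α M K ρ ∧
      (∀ (C : ℝ) (τ : C1On M →ₗ[ℂ] C1On M →ₗ[ℂ] ℂ), IsBoundedExtension α M C τ → τ = ρ) ∧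
      ∃ G : ℂ × ℂ → ℂ,
        AnalyticOnNhd ℂ G (cutPlane M ×ˢ cutPlane M) ∧
        (∀ z w : ℂ, M < ‖z‖ → M < ‖w‖ →
          Summable (cauchyTerm α z w) ∧ G (z, w) = secondOrderCauchy α z w) ∧
        ∀ (z w : ℂ) (hz : z.im ≠ 0) (hw : w.im ≠ 0),
          G (z, w) = ρ (restrC1 M (resolventFn z) (contDiff_resolventFn hz))
            (restrC1 M (resolventFn w) (contDiff_resolventFn hw)) ∧
          Tendsto (fun N => ccov (P N) (E.traceResolvent z N) (E.traceResolvent w N))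
            atTop (𝓝 (G (z, w))) := by
  obtain ⟨B, hBK, hB⟩ := hA0.exists_bilinear_limit_ccov hA1 hA2 hM hK
  have hBα : ∀ m n, B (derivOn M (monomialFn m) (contDiff_monomialFn m))
      (derivOn M (monomialFn n) (contDiff_monomialFn n)) = α m n := fun m n => by
    have h := hB _ _ (contDiff_monomialFn m) (contDiff_monomialFn n)
      (HasPolyGrowth.monomialFn m) (HasPolyGrowth.monomialFn n)
    simp only [SelfAdjointEnsemble.linStat_monomialFn] at h
    exact tendsto_nhds_unique h (hA0.second m n)
  set ρ : C1On M →ₗ[ℂ] C1On M →ₗ[ℂ] ℂ :=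
    (ContinuousLinearMap.toLinearMap₁₂ B).compl₁₂ (derivC1 hM) (derivC1 hM)
  have hρ : ∀ (f g : ℝ → ℂ) (hf : ContDiff ℝ 1 f) (hg : ContDiff ℝ 1 g),
      ρ (restrC1 M f hf) (restrC1 M g hg) = B (derivOn M f hf) (derivOn M g hg) := by
    intro f g hf hg
    rw [← derivC1_restrC1 hM hf, ← derivC1_restrC1 hM hg]
    rfl
  have hext : IsBoundedExtension α M K ρ :=
    ⟨fun m n => (hρ _ _ _ _).trans (hBα m n), fun f g hf hg => by
      rw [hρ, ← norm_derivOn hf, ← norm_derivOn hg]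
      exact hBK _ _⟩
  refine ⟨ρ, hext, fun C τ hτ => hτ.eq hM hext,
    fun p => B (resolventOn M p.1 ^ 2) (resolventOn M p.2 ^ 2), ?_,
    fun z w hz hw => summable_cauchyTerm_and_tsum hBα hBK hM hz hw, fun z w hz hw => ⟨?_, ?_⟩⟩
  · rintro ⟨z, w⟩ ⟨hz, hw⟩
    have h1 : AnalyticAt ℂ (fun p : ℂ × ℂ => resolventOn M p.1 ^ 2) (z, w) :=
      (AnalyticAt.comp (g := resolventOn M) (analyticAt_resolventOn hz) analyticAt_fst).pow 2
    have h2 : AnalyticAt ℂ (fun p : ℂ × ℂ => resolventOn M p.2 ^ 2) (z, w) :=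
      (AnalyticAt.comp (g := resolventOn M) (analyticAt_resolventOn hw) analyticAt_snd).pow 2
    exact (B.analyticAt_bilinear _).comp₂ h1 h2
  · rw [hρ, derivOn_resolventFn hz, derivOn_resolventFn hw]
  · have h := hB _ _ (contDiff_resolventFn hz) (contDiff_resolventFn hw)
      (HasPolyGrowth.resolventFn hz) (HasPolyGrowth.resolventFn hw)
    simp only [E.linStat_resolventFn hz, E.linStat_resolventFn hw] at h
    rwa [derivOn_resolventFn hz, derivOn_resolventFn hw] at h
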